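/- Let $G$ be a finite simple chordal graph (no induced cycle on four or more vertices). A clique cover of $G$ is a set of cliques of $G$ such that every edge of $G$ lies in at least one of them; it is optimal if no clique cover has fewer cliques, and $cc(G)$ is the number of cliques in an optimal clique cover. Positive zero forcing: if $B$ is the set of black vertices, $u\in B$, and $w$ is the only neighbour of $u$ in some connected component of $G-B$, then $u$ may force $w$, that is, $w$ becomes black; $Z_+(G)$ is the smallest size of a set $B$ from which repeated forcing can turn all vertices black. Run the following algorithm on each connected component $H$ of $G$. Let $(v_1,\dots,v_n)$ be an ordering of $V(H)$ given by lexicographic breadth-first search: the vertices receive the numbers $n,n-1,\dots,1$ in this order; the next number goes to an unnumbered vertex whose label (initially the empty word) is lexicographically largest, ties being broken arbitrarily, and is then appended to the labels of its unnumbered neighbours; $v_i$ is the vertex with number $i$. All vertices and edges are initially uncoloured. For $i=1,\dots,n$, let $H_i=H-\{v_1,\dots,v_{i-1}\}$ and let $C$ consist of $v_i$ and its neighbours in $H_i$. If some edge $e$ of $H_i$ incident to $v_i$ is uncoloured, choose such an $e$, colour $e$ black and all other uncoloured edges of $H$ with both ends in $C$ red, and colour $v_i$ white; otherwise colour $v_i$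 black. Let $w_1,\dots,w_m$ be the vertices of $G$ coloured white in all these runs, let $C_j$ be the set $C$ at the moment when $w_j$ is coloured white, and let $\mathcal C(G)=\{C_1,\dots,C_m\}$. Such runs exist, and for every choice of the orderings and of the edges $e$: 1. $\mathcal C(G)$ is an optimal clique cover of $G$, and it consists of $m$ distinct cliques, one for each white vertex. Moreover, 2. $|V(G)|-cc(G)=Z_+(G)$. -/

import Mathlib

namespace ZplusChordal

/-- A graph is chordal if it has no induced cycle on four or more vertices. -/
def IsChordal {V : Type*} (G : SimpleGraph V) : Prop :=
  ∀ n : ℕ, 4 ≤ n → ¬ (SimpleGraph.cycleGraph n).IsIndContained G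

/-! ### Clique covers -/

/-- A clique cover: a set of cliques of `G` such that every edge of `G` lies in one of them. -/
def IsCliqueCover {V : Type*} (G : SimpleGraph V) (C : Set (Set V)) : Prop :=
  (∀ K ∈ C, G.IsClique K) ∧ ∀ u v : V, G.Adj u v → ∃ K ∈ C, u ∈ K ∧ v ∈ K

/-- An optimal clique cover: one with the fewest cliques. -/
def IsOptimalCliqueCover {V : Type*} (G : SimpleGraph V) (C : Set (Set V)) : Prop :=
  IsCliqueCover G C ∧ ∀ D : Set (Set V), IsCliqueCover G D → C.ncard ≤ D.ncard

/-- The clique cover number `cc(G)`. -/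
noncomputable def cliqueCoverNumber {V : Type*} (G : SimpleGraph V) : ℕ :=
  sInf {k : ℕ | ∃ C : Set (Set V), IsCliqueCover G C ∧ C.ncard = k}

/-! ### Positive zero forcing -/

/-- The positive colour change rule: with `B` the set of black vertices, the black vertex `u` can
force `w` if `w` is the only neighbour of `u` in some connected component of `G - B`. -/
def PosForces {V : Type*} (G : SimpleGraph V) (B : Set V) (u w : V) : Prop :=
  u ∈ B ∧ ∃ W : (G.induce Bᶜ).ConnectedComponent,
    {x : V | x ∈ Subtype.val '' W.supp ∧ G.Adj u x} = {w}

/-- One application of the positive colour change rule, turning the black set `B` into `B'`. -/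
def PosForceStep {V : Type*} (G : SimpleGraph V) (B B' : Set V) : Prop :=
  ∃ u w : V, PosForces G B u w ∧ B' = insert w B

/-- A positive zero forcing set: repeated forcing from it can turn all vertices black. -/
def IsPosZeroForcingSet {V : Type*} (G : SimpleGraph V) (B : Set V) : Prop :=
  Relation.ReflTransGen (PosForceStep G) B Set.univ

/-- The positive zero forcing number `Z₊(G)`. -/
noncomputable def posZeroForcingNumber {V : Type*} (G : SimpleGraph V) : ℕ :=
  sInf {k : ℕ | ∃ B : Set V, IsPosZeroForcingSet G B ∧ B.ncard = k}

/-! ### Lexicographic breadth-first search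

The search numbers the vertices `n, n - 1, …, 1`. A list `[v_i, …, v_n]` records the vertices
numbered so far, the most recently numbered one first. -/

open Classical in
/-- The label of the vertex `w` after the vertices of the list have been numbered: whenever a
vertex adjacent to `w` receives a number, this number is appended to the label of `w`. -/
noncomputable def lexLabel {V : Type*} (G : SimpleGraph V) : List V → V → List ℕ
  | [], _ => []
  | x :: L, w =>
      if G.Adj x w then lexLabel G L w ++ [Nat.card V - L.length] else lexLabel G L w

/-- The lists produced by lexicographic breadth-first search: the next vertex to be numbered is
an unnumbered vertex whose label is lexicographically largest (ties broken arbitrarily). -/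
inductive IsLexBFSList {V : Type*} (G : SimpleGraph V) : List V → Prop
  | nil : IsLexBFSList G []
  | cons (v : V) (L : List V) (hL : IsLexBFSList G L) (hv : v ∉ L)
      (hmax : ∀ w : V, w ∉ L → ¬ lexLabel G L v < lexLabel G L w) : IsLexBFSList G (v :: L)

/-- A complete ordering `(v_1, …, v_n)` given by lexicographic breadth-first search. -/
def IsLexBFSOrdering {V : Type*} (G : SimpleGraph V) (L : List V) : Prop :=
  IsLexBFSList G L ∧ ∀ v : V, v ∈ L

/-! ### Algorithm Zplus-Chordal -/

/-- Colours of edges. -/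
inductive EdgeColour
  | black
  | red

/-- Colours of vertices. -/
inductive VertexColour
  | black
  | white

/-- A configuration of the algorithm: the vertices of the current graph `G_i` in the order in
which they will be removed, the partial edge and vertex colourings (`none` is uncoloured), and the
cliques `C_i` recorded for the vertices coloured white so far. -/
structure Config (V : Type*) where
  rest : List V
  edge : Sym2 V → Option EdgeColour
  vertex : V → Option VertexColour
  cliques : Set (Set V)

/-- The initial configuration for the ordering `L`. -/
def Config.init {V : Type*} (L : List V) : Config V where
  rest := L
  edge := fun _ => none
  vertex := fun _ => none
  cliques := ∅

/-- The set consisting of `v` and its neighbours among the vertices listed in `rest`. -/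
def closedNbhd {V : Type*} (G : SimpleGraph V) (v : V) (rest : List V) : Set V :=
  insert v {u | u ∈ rest ∧ G.Adj v u}

open Classical in
/-- Colour the edge `e` black and all other uncoloured edges of `G` with both ends in `K` red. -/
noncomputable def colourEdges {V : Type*} (G : SimpleGraph V) (K : Set V) (e : Sym2 V)
    (c : Sym2 V → Option EdgeColour) : Sym2 V → Option EdgeColour := fun f =>
  if f = e then some EdgeColour.black
  else if c f = none ∧ f ∈ G.edgeSet ∧ ∀ x ∈ f, x ∈ K then some EdgeColour.red
  else c f

open Classical in
/-- One iteration of the algorithm, removing the first vertex `v` of the current graph. In `white`,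
some edge `{v, u}` of the current graph is uncoloured. In `black`, all edges of the current graph
at `v` are coloured; this includes the last remaining vertex, which has no edges. -/
inductive Step {V : Type*} (G : SimpleGraph V) : Config V → Config V → Prop
  | white (v u : V) (rest : List V) (ec : Sym2 V → Option EdgeColour)
      (vc : V → Option VertexColour) (C : Set (Set V))
      (hu : u ∈ rest) (hadj : G.Adj v u) (hnone : ec s(v, u) = none) :
      Step G ⟨v :: rest, ec, vc, C⟩
        ⟨rest, colourEdges G (closedNbhd G v rest) s(v, u) ec,
          Function.update vc v (some VertexColour.white), insert (closedNbhd G v rest) C⟩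
  | black (v : V) (rest : List V) (ec : Sym2 V → Option EdgeColour)
      (vc : V → Option VertexColour) (C : Set (Set V))
      (hall : ∀ u ∈ rest, G.Adj v u → ec s(v, u) ≠ none) :
      Step G ⟨v :: rest, ec, vc, C⟩
        ⟨rest, ec, Function.update vc v (some VertexColour.black), C⟩

/-- `F` is a final configuration of a run of the algorithm on the graph `G`. -/
def IsRunResult {V : Type*} (G : SimpleGraph V) (F : Config V) : Prop :=
  ∃ L : List V, IsLexBFSOrdering G L ∧
    Relation.ReflTransGen (Step G) (Config.init L) F ∧ F.rest = []

/-- The algorithm is run on each connected component of `G`; `F c` is the final configuration of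
the run on the component `c`. -/
def IsResult {V : Type*} (G : SimpleGraph V)
    (F : ∀ c : G.ConnectedComponent, Config c.supp) : Prop :=
  ∀ c : G.ConnectedComponent, IsRunResult (G.induce c.supp) (F c)

/-- The set of white vertices `V_white(G)`. -/
def whiteVertices {V : Type*} {G : SimpleGraph V}
    (F : ∀ c : G.ConnectedComponent, Config c.supp) : Set V :=
  {v | ∃ (c : G.ConnectedComponent) (h : v ∈ c.supp),
    (F c).vertex ⟨v, h⟩ = some VertexColour.white}

/-- The family `𝒞(G)` of the cliques recorded for the white vertices. -/
def cliqueFamily {V : Type*} {G : SimpleGraph V}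
    (F : ∀ c : G.ConnectedComponent, Config c.supp) : Set (Set V) :=
  {K | ∃ c : G.ConnectedComponent, ∃ K' ∈ (F c).cliques, K = Subtype.val '' K'}

end ZplusChordal

namespace ZplusChordal

open Relation

/-! ### Forces use up the cliques of a clique cover -/

/-! Number each vertex by its position in the search list. For a chordal graph this is a perfect
elimination numbering (`HasLexProperty.isPerfectElimination`), so a vertex together with its later
neighbours is a clique, `upperNbhd`. A white vertex has a fresh edge to a later vertex, one lying in
no earlier recorded clique. No clique contains the fresh edges of two white vertices `v` and `w`
with `v` earlier: both ends of the edge of `w` would be later neighbours of `v`, so this edge would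
lie in the clique recorded at `v`. Hence every clique cover has at least as many cliques as there
are white vertices, and the recorded cliques attain this bound.

For positive zero forcing, fix a clique cover. When `u` forces `w`, a clique of the cover containing
the edge `uw` becomes entirely black, so a forcing set misses at most cc(G) vertices. Conversely,
the vertices that are not white force the white ones in decreasing order, each through its fresh
edge (`IsWhiteSet.exists_posForceStep`). Both numbers are thus determined by the number of white
vertices. -/

theorem PosForces.exists_clique {V : Type*} {G : SimpleGraph V} {D : Set (Set V)}
    (hD : IsCliqueCover G D) {B : Set V} {u w : V} (h : PosForces G B u w) :
    ∃ K ∈ D, w ∈ K ∧ w ∉ B ∧ K ⊆ insert w B := by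
  obtain ⟨hu, W, hW⟩ := h
  have hw : w ∈ {x : V | x ∈ Subtype.val '' W.supp ∧ G.Adj u x} := by rw [hW]; rfl
  obtain ⟨⟨w', hw', rfl⟩, huw⟩ := hw
  obtain ⟨K, hK, huK, hwK⟩ := hD.2 _ _ huw
  refine ⟨K, hK, hwK, w'.2, fun x hx => ?_⟩
  -- A second non-black vertex of `K` would be adjacent to `w`, hence in the same component, and
  -- also adjacent to `u`.
  by_contra hxn
  rw [Set.mem_insert_iff, not_or] at hxn
  have hclique := hD.1 K hK
  have hux : G.Adj u x := hclique huK hx (by rintro rfl; exact hxn.2 hu)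
  have hwx : G.Adj w' x := hclique hwK hx (Ne.symm hxn.1)
  have hmem : x ∈ {x : V | x ∈ Subtype.val '' W.supp ∧ G.Adj u x} := by
    refine ⟨⟨⟨x, hxn.2⟩, ?_, rfl⟩, hux⟩
    rw [SimpleGraph.ConnectedComponent.mem_supp_iff] at hw' ⊢
    rw [← hw', SimpleGraph.ConnectedComponent.eq]
    exact SimpleGraph.Adj.reachable (G := G.induce Bᶜ) (u := ⟨x, hxn.2⟩) (v := w') hwx.symm
  rw [hW] at hmem
  exact hxn.1 hmem

/-- Each force blackens the last non-black vertex of some clique of `D`, so different forces use up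
different cliques. -/
theorem ncard_compl_le_of_forcing {V : Type*} [Finite V] {G : SimpleGraph V} {D : Set (Set V)}
    (hD : IsCliqueCover G D) {B : Set V} (hB : IsPosZeroForcingSet G B) :
    Bᶜ.ncard ≤ {K ∈ D | ¬ K ⊆ B}.ncard := by
  induction hB using ReflTransGen.head_induction_on with
  | refl => simp
  | head h h0 ih =>
    rename_i B B'
    obtain ⟨u, w, hf, rfl⟩ := h
    obtain ⟨K, hK, hwK, hwB, hKB⟩ := hf.exists_clique hD
    have hsub : insert K {K ∈ D | ¬ K ⊆ insert w B} ⊆ {K ∈ D | ¬ K ⊆ B} := by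
      rintro K' (rfl | ⟨h1, h2⟩)
      · exact ⟨hK, fun h => hwB (h hwK)⟩
      · exact ⟨h1, fun h => h2 (h.trans (Set.subset_insert _ _))⟩
    have h1 := Set.ncard_le_ncard hsub (Set.toFinite _)
    rw [Set.ncard_insert_of_notMem (fun h => h.2 hKB)] at h1
    have h2 : Bᶜ = insert w (insert w B)ᶜ := by
      ext x
      by_cases hx : x = w <;> simp [hx, hwB]
    rw [h2, Set.ncard_insert_of_notMem (by simp)]
    omega

theorem card_le_ncard_add_ncard {V : Type*} [Finite V] {G : SimpleGraph V} {D : Set (Set V)}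
    (hD : IsCliqueCover G D) {B : Set V} (hB : IsPosZeroForcingSet G B) :
    Nat.card V ≤ B.ncard + D.ncard := by
  have h1 := ncard_compl_le_of_forcing hD hB
  have h2 : {K ∈ D | ¬ K ⊆ B}.ncard ≤ D.ncard :=
    Set.ncard_le_ncard (fun _ h => h.1) (Set.toFinite _)
  have h3 := Set.ncard_add_ncard_compl B
  omega

/-! ### Perfect elimination numberings -/

/-- A numbering of the vertices, separating adjacent ones, such that the neighbours of a vertex
with larger numbers are pairwise adjacent. -/
structure IsPerfectElimination {V : Type*} (G : SimpleGraph V) (f : V → ℕ) : Prop where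
  ne_of_adj : ∀ ⦃x y⦄, G.Adj x y → f x ≠ f y
  adj_of_lt : ∀ ⦃v b c⦄, G.Adj v b → G.Adj v c → f v < f b → f v < f c → b ≠ c → G.Adj b c

/-- A vertex together with its neighbours of larger number. -/
def upperNbhd {V : Type*} (G : SimpleGraph V) (f : V → ℕ) (v : V) : Set V :=
  insert v {u | G.Adj v u ∧ f v < f u}

/-- The outcome of the colouring algorithm for the numbering `f`: each white vertex `v` has an edge
to a later vertex that lies in no earlier recorded set, and each edge from a vertex that is not
white to a later vertex lies in a recorded set. -/
structure IsWhiteSet {V : Type*} (G : SimpleGraph V) (f : V → ℕ) (W : Set V) : Prop where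
  exists_fresh : ∀ v ∈ W, ∃ u, G.Adj v u ∧ f v < f u ∧
    ∀ k ∈ W, f k < f v → ¬ (v ∈ upperNbhd G f k ∧ u ∈ upperNbhd G f k)
  covered : ∀ v ∉ W, ∀ u, G.Adj v u → f v < f u →
    ∃ k ∈ W, v ∈ upperNbhd G f k ∧ u ∈ upperNbhd G f k

section

variable {V : Type*} {G : SimpleGraph V} {f : V → ℕ} {W : Set V}

theorem IsPerfectElimination.isClique_upperNbhd (hf : IsPerfectElimination G f) (v : V) :
    G.IsClique (upperNbhd G f v) := by
  rintro x (rfl | hx) y (rfl | hy) hne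
  · exact absurd rfl hne
  · exact hy.1
  · exact hx.1.symm
  · exact hf.adj_of_lt hx.1 hy.1 hx.2 hy.2 hne

theorem IsWhiteSet.isCliqueCover (hf : IsPerfectElimination G f) (hW : IsWhiteSet G f W) :
    IsCliqueCover G (upperNbhd G f '' W) := by
  refine ⟨?_, ?_⟩
  · rintro _ ⟨v, -, rfl⟩
    exact hf.isClique_upperNbhd v
  · have key : ∀ x y, G.Adj x y → f x < f y → ∃ K ∈ upperNbhd G f '' W, x ∈ K ∧ y ∈ K := by
      intro x y hxy hlt
      by_cases hx : x ∈ W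
      · exact ⟨_, ⟨x, hx, rfl⟩, Or.inl rfl, Or.inr ⟨hxy, hlt⟩⟩
      · obtain ⟨k, hk, h⟩ := hW.covered x hx y hxy hlt
        exact ⟨_, ⟨k, hk, rfl⟩, h⟩
    intro x y hxy
    rcases lt_or_gt_of_ne (hf.ne_of_adj hxy) with h | h
    · exact key x y hxy h
    · obtain ⟨K, hK, h1, h2⟩ := key y x hxy.symm h
      exact ⟨K, hK, h2, h1⟩

/-- The edges `v`–`e v` are the fresh ones; they serve as a lower-bound certificate for every clique
cover, since each needs a clique of its own. -/
theorem IsWhiteSet.exists_separated_edges (hf : IsPerfectElimination G f)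
    (hW : IsWhiteSet G f W) : ∃ e : V → V, (∀ v ∈ W, G.Adj v (e v) ∧ f v < f (e v)) ∧
      ∀ K, G.IsClique K → ∀ v ∈ W, ∀ w ∈ W, v ∈ K → e v ∈ K → w ∈ K → e w ∈ K → v = w := by
  classical
  choose! e he using hW.exists_fresh
  refine ⟨e, fun v hv => ⟨(he v hv).1, (he v hv).2.1⟩, ?_⟩
  have key : ∀ K, G.IsClique K → ∀ v ∈ W, ∀ w ∈ W, v ∈ K → w ∈ K → e w ∈ K → ¬ f v < f w := by
    intro K hK v hv w hw hvK hwK hewK hlt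
    obtain ⟨-, h2, h3⟩ := he w hw
    refine h3 v hv hlt ⟨Or.inr ⟨hK hvK hwK ?_, hlt⟩, Or.inr ⟨hK hvK hewK ?_, hlt.trans h2⟩⟩
    · rintro rfl; exact lt_irrefl _ hlt
    · intro h; rw [← h] at h2; exact lt_asymm hlt h2
  intro K hK v hv w hw hvK hevK hwK hewK
  by_contra hne
  rcases lt_or_gt_of_ne (hf.ne_of_adj (hK hvK hwK hne)) with h | h
  · exact key K hK v hv w hw hvK hwK hewK h
  · exact key K hK w hw v hv hwK hvK hevK h

theorem IsWhiteSet.injOn_upperNbhd (hf : IsPerfectElimination G f) (hW : IsWhiteSet G f W) :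
    Set.InjOn (upperNbhd G f) W := by
  obtain ⟨e, he, hsep⟩ := hW.exists_separated_edges hf
  intro v hv w hw h
  refine hsep _ (hf.isClique_upperNbhd v) v hv w hw (Or.inl rfl) (Or.inr (he v hv)) ?_ ?_
  · rw [h]; exact Or.inl rfl
  · rw [h]; exact Or.inr (he w hw)

theorem IsWhiteSet.ncard_le [Finite V] (hf : IsPerfectElimination G f) (hW : IsWhiteSet G f W)
    {D : Set (Set V)} (hD : IsCliqueCover G D) : W.ncard ≤ D.ncard := by
  obtain ⟨e, he, hsep⟩ := hW.exists_separated_edges hf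
  have h : ∀ v ∈ W, ∃ K ∈ D, v ∈ K ∧ e v ∈ K := fun v hv => hD.2 _ _ (he v hv).1
  choose! K hK using h
  refine Set.ncard_le_ncard_of_injOn K (fun v hv => (hK v hv).1) ?_ (Set.toFinite _)
  intro v hv w hw hvw
  obtain ⟨h1, h2, h3⟩ := hK v hv
  obtain ⟨-, h4, h5⟩ := hK w hw
  exact hsep _ (hD.1 _ h1) v hv w hw h2 h3 (hvw ▸ h4) (hvw ▸ h5)

/-! ### The vertices that are not white form a forcing set -/

/-- Adjacency within a set of vertices. -/
def AdjOn (G : SimpleGraph V) (S : Set V) (x y : V) : Prop := x ∈ S ∧ y ∈ S ∧ G.Adj x y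

/-- A connection through a set all of whose vertices precede `a` and `b` can be contracted to a
single common neighbour of `a` and `b`. -/
theorem IsPerfectElimination.exists_common_nbr [Finite V] (hf : IsPerfectElimination G f)
    {a b : V} : ∀ (n : ℕ) (S : Set V), S.ncard = n → a ∉ S → b ∉ S →
      (∀ p ∈ S, f p ≤ f a ∧ f p ≤ f b) → ∀ x ∈ S, ∀ w ∈ S, G.Adj x a → G.Adj w b →
      ReflTransGen (AdjOn G S) x w → ∃ y ∈ S, G.Adj y a ∧ G.Adj y b := by
  intro n
  induction n with
  | zero =>
    intro S hS _ _ _ x hx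
    rw [Set.ncard_eq_zero] at hS
    simp [hS] at hx
  | succ n ih =>
    intro S hS haS hbS hle x hx w hw hxa hwb hxw
    -- The minimum of `S` can be deleted: its neighbours in `S`, as well as `a` or `b` if adjacent
    -- to it, are later neighbours of `p` and so pairwise adjacent.
    obtain ⟨p, hp, hmin⟩ := Set.exists_min_image S f (Set.toFinite S) ⟨x, hx⟩
    have hlt : ∀ q ∈ S, G.Adj p q → f p < f q := fun q hq h =>
      lt_of_le_of_ne (hmin q hq) (hf.ne_of_adj h)
    have hn : (S \ {p}).ncard = n := by
      rw [Set.ncard_sdiff_singleton_of_mem hp, hS]; rfl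
    have ih' := ih (S \ {p}) hn (fun h => haS h.1) (fun h => hbS h.1) (fun q hq => hle q hq.1)
    -- A visit to `p` is short-cut by an edge between its two neighbours on the walk; the second
    -- alternative describes a walk that currently stands at `p`.
    have bypass : ∀ x ∈ S, x ≠ p → ∀ w, ReflTransGen (AdjOn G S) x w →
        (w ≠ p ∧ ReflTransGen (AdjOn G (S \ {p})) x w) ∨
        (w = p ∧ ∃ z ∈ S \ {p}, G.Adj z p ∧ ReflTransGen (AdjOn G (S \ {p})) x z) := by
      intro x hx hxp w hxw
      induction hxw with
      | refl => exact Or.inl ⟨hxp, .refl⟩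
      | tail h0 hyz ih =>
        rename_i y z
        obtain ⟨hy, hz, hyz⟩ := hyz
        rcases ih with ⟨hyp, hxy⟩ | ⟨rfl, t, ht, htp, hxt⟩
        · by_cases hzp : z = p
          · subst hzp
            exact Or.inr ⟨rfl, y, ⟨hy, hyp⟩, hyz, hxy⟩
          · exact Or.inl ⟨hzp, hxy.tail ⟨⟨hy, hyp⟩, ⟨hz, hzp⟩, hyz⟩⟩
        · refine Or.inl ⟨hyz.ne', ?_⟩
          by_cases htz : t = z
          · exact htz ▸ hxt
          · exact hxt.tail ⟨ht, ⟨hz, hyz.ne'⟩, hf.adj_of_lt htp.symm hyz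
              (hlt t ht.1 htp.symm) (hlt z hz hyz) htz⟩
    have upper : ∀ c q, f p ≤ f c → c ∉ S → G.Adj p c → q ∈ S → G.Adj p q → G.Adj q c := by
      intro c q hpc hc h1 hq h2
      refine hf.adj_of_lt h2 h1 (hlt q hq h2) (lt_of_le_of_ne hpc (hf.ne_of_adj h1)) ?_
      rintro rfl; exact hc hq
    -- If `p` is an end of the walk, the next vertex inherits the adjacency to `a` or `b` by
    -- `upper`.
    by_cases hxp : x = p
    · subst hxp
      rcases ReflTransGen.cases_head hxw with rfl | ⟨x', ⟨-, hx', hxx'⟩, hxw'⟩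
      · exact ⟨x, hx, hxa, hwb⟩
      · have hx'a := upper a x' (hle x hp).1 haS hxa hx' hxx'
        rcases bypass x' hx' hxx'.ne' w hxw' with ⟨h1, h2⟩ | ⟨rfl, -⟩
        · obtain ⟨y, hy, h⟩ := ih' x' ⟨hx', hxx'.ne'⟩ w ⟨hw, h1⟩ hx'a hwb h2
          exact ⟨y, hy.1, h⟩
        · exact ⟨w, hw, hxa, hwb⟩
    · rcases bypass x hx hxp w hxw with ⟨h1, h2⟩ | ⟨rfl, z, hz, hzw, h2⟩
      · obtain ⟨y, hy, h⟩ := ih' x ⟨hx, hxp⟩ w ⟨hw, h1⟩ hxa hwb h2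
        exact ⟨y, hy.1, h⟩
      · obtain ⟨y, hy, h⟩ := ih' x ⟨hx, hxp⟩ z hz hxa
          (upper b z (hle w hp).2 hbS hwb hz.1 hzw.symm) h2
        exact ⟨y, hy.1, h⟩

/-- Cut the walk after its last visit to `v`. -/
theorem exists_adj_reflTransGen_diff {S : Set V} {v x : V}
    (h : ReflTransGen (AdjOn G S) v x) (hxv : x ≠ v) :
    ∃ y ∈ S \ {v}, G.Adj v y ∧ x ∈ S \ {v} ∧ ReflTransGen (AdjOn G (S \ {v})) y x := by
  induction h with
  | refl => exact absurd rfl hxv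
  | tail h0 hyz ih =>
    rename_i y z
    obtain ⟨hy, hz, hyz⟩ := hyz
    by_cases hyv : y = v
    · subst hyv
      exact ⟨z, ⟨hz, hxv⟩, hyz, ⟨hz, hxv⟩, .refl⟩
    · obtain ⟨t, ht, hvt, hyS, hty⟩ := ih hyv
      exact ⟨t, ht, hvt, ⟨hz, hxv⟩, hty.tail ⟨hyS, ⟨hz, hxv⟩, hyz⟩⟩

theorem IsWhiteSet.exists_posForceStep [Finite V] (hf : IsPerfectElimination G f)
    (hW : IsWhiteSet G f W) {B : Set V} (hB : Bᶜ ⊆ W) (hne : Bᶜ.Nonempty) :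
    ∃ v ∉ B, PosForceStep G B (insert v B) := by
  -- The largest non-black vertex is forced by the later end of its fresh edge, which is already
  -- black by maximality.
  obtain ⟨v, hv, hmax⟩ := Set.exists_max_image Bᶜ f (Set.toFinite _) hne
  obtain ⟨u, hvu, hlt, hu⟩ := hW.exists_fresh v (hB hv)
  have huB : u ∈ B := by
    by_contra h
    exact absurd (hmax u h) (not_le.mpr hlt)
  refine ⟨v, hv, u, v, ⟨huB, (G.induce Bᶜ).connectedComponentMk ⟨v, hv⟩, ?_⟩, rfl⟩
  ext x
  constructor
  · rintro ⟨⟨x, hx, rfl⟩, hux⟩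
    by_contra hxv
    rw [SimpleGraph.ConnectedComponent.mem_supp_iff, SimpleGraph.ConnectedComponent.eq] at hx
    have hvx : ReflTransGen (AdjOn G Bᶜ) v x.1 := by
      have := (SimpleGraph.reachable_iff_reflTransGen _ _).mp hx.symm
      exact ReflTransGen.lift (p := AdjOn G Bᶜ) Subtype.val (fun a b h => ⟨a.2, b.2, h⟩) _ _ this
    obtain ⟨y, hy, hvy, hxS, hyx⟩ := exists_adj_reflTransGen_diff hvx hxv
    -- Another neighbour of `u` in the component of `v` yields an earlier white `k` adjacent to both
    -- `u` and `v`, so the edge would not be fresh.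
    obtain ⟨k, hk, hkv, hku⟩ := hf.exists_common_nbr (a := v) (b := u) _ (Bᶜ \ {v}) rfl
      (fun h => h.2 rfl) (fun h => h.1 huB)
      (fun p hp => ⟨hmax p hp.1, (hmax p hp.1).trans hlt.le⟩) y hy x hxS hvy.symm hux.symm hyx
    have hkv' : f k < f v := lt_of_le_of_ne (hmax k hk.1) (hf.ne_of_adj hkv)
    exact hu k (hB hk.1) hkv' ⟨Or.inr ⟨hkv, hkv'⟩, Or.inr ⟨hku, hkv'.trans hlt⟩⟩
  · rintro rfl
    exact ⟨⟨⟨x, hv⟩, rfl, rfl⟩, hvu.symm⟩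

theorem IsWhiteSet.isPosZeroForcingSet_compl [Finite V] (hf : IsPerfectElimination G f)
    (hW : IsWhiteSet G f W) : IsPosZeroForcingSet G Wᶜ := by
  have key : ∀ (n : ℕ) (B : Set V), Bᶜ.ncard = n → Bᶜ ⊆ W →
      ReflTransGen (PosForceStep G) B Set.univ := by
    intro n
    induction n with
    | zero =>
      intro B hn _
      rw [Set.ncard_eq_zero, Set.compl_empty_iff] at hn
      rw [hn]
    | succ n ih =>
      intro B hn hB
      obtain ⟨v, hv, hstep⟩ := hW.exists_posForceStep hf hB
        (Set.nonempty_of_ncard_ne_zero (by omega))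
      have hc : (insert v B)ᶜ = Bᶜ \ {v} := by
        ext x; simp [and_comm]
      refine ReflTransGen.head hstep (ih _ ?_ ?_)
      · rw [hc, Set.ncard_sdiff_singleton_of_mem hv, hn]; rfl
      · rw [hc]; exact Set.sdiff_subset.trans hB
  exact key _ Wᶜ rfl (by rw [compl_compl])

theorem IsWhiteSet.card_sub_cliqueCoverNumber [Finite V] (hf : IsPerfectElimination G f)
    (hW : IsWhiteSet G f W) :
    (Nat.card V : ℤ) - (cliqueCoverNumber G : ℤ) = (posZeroForcingNumber G : ℤ) := by
  have hcover := hW.isCliqueCover hf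
  have hcard : (upperNbhd G f '' W).ncard = W.ncard :=
    (hW.injOn_upperNbhd hf).ncard_image
  have hcc : cliqueCoverNumber G = W.ncard := by
    refine le_antisymm (Nat.sInf_le ⟨_, hcover, hcard⟩) ?_
    refine le_csInf ⟨_, _, hcover, hcard⟩ ?_
    rintro k ⟨D, hD, rfl⟩
    exact hW.ncard_le hf hD
  have hforce := hW.isPosZeroForcingSet_compl hf
  have hz : posZeroForcingNumber G = Wᶜ.ncard := by
    refine le_antisymm (Nat.sInf_le ⟨_, hforce, rfl⟩) ?_
    refine le_csInf ⟨_, _, hforce, rfl⟩ ?_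
    rintro k ⟨B, hB, rfl⟩
    have h1 := card_le_ncard_add_ncard hcover hB
    have h2 := Set.ncard_add_ncard_compl W
    omega
  have h := Set.ncard_add_ncard_compl W
  rw [hcc, hz]
  omega

end

/-! ### Separation in chordal graphs -/

theorem IsChordal.induce {V : Type*} {G : SimpleGraph V} (hG : IsChordal G) (S : Set V) :
    IsChordal (G.induce S) := fun n hn h =>
  hG n hn (h.trans ⟨SimpleGraph.Embedding.induce S⟩)

theorem cycleGraph_adj_of_lt {n : ℕ} {i j : Fin n} (hij : i < j) :
    (SimpleGraph.cycleGraph n).Adj i j ↔ j.1 = i.1 + 1 ∨ (i.1 = 0 ∧ j.1 + 1 = n) := by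
  rw [SimpleGraph.cycleGraph_adj', Fin.sub_val_of_le hij.le, Fin.coe_sub_iff_lt.mpr hij]
  have := Fin.lt_def.mp hij
  omega

theorem isIndContained_cycleGraph {V : Type*} {G : SimpleGraph V} {n : ℕ} (g : Fin n → V)
    (hg : ∀ i j : Fin n, i < j → g i ≠ g j ∧
      (G.Adj (g i) (g j) ↔ j.1 = i.1 + 1 ∨ (i.1 = 0 ∧ j.1 + 1 = n))) :
    (SimpleGraph.cycleGraph n).IsIndContained G := by
  refine ⟨⟨⟨g, fun i j h => ?_⟩, fun {i j} => ?_⟩⟩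
  · by_contra hne
    rcases lt_or_gt_of_ne hne with hlt | hlt
    · exact (hg i j hlt).1 h
    · exact (hg j i hlt).1 h.symm
  · change G.Adj (g i) (g j) ↔ _
    rcases lt_trichotomy i j with hlt | rfl | hlt
    · rw [(hg i j hlt).2, cycleGraph_adj_of_lt hlt]
    · simp
    · rw [G.adj_comm, (hg j i hlt).2, SimpleGraph.adj_comm, cycleGraph_adj_of_lt hlt]

/-- On a walk of minimal length, vertices at distinct positions are distinct, and adjacent only if
the positions are consecutive. -/
theorem getVert_of_length_eq_dist {V : Type*} {G : SimpleGraph V} {a b : V} (p : G.Walk a b)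
    (hp : p.length = G.dist a b) {i j : ℕ} (hij : i < j) (hj : j ≤ p.length) :
    p.getVert i ≠ p.getVert j ∧ (G.Adj (p.getVert i) (p.getVert j) → j = i + 1) := by
  constructor
  · intro h
    have := SimpleGraph.dist_le ((p.take i).append ((p.drop j).copy h.symm rfl))
    simp only [SimpleGraph.Walk.length_append, SimpleGraph.Walk.length_copy,
      SimpleGraph.Walk.take_length, SimpleGraph.Walk.drop_length] at this
    omega
  · intro h
    have := SimpleGraph.dist_le ((p.take i).append (SimpleGraph.Walk.cons h (p.drop j)))
    simp only [SimpleGraph.Walk.length_append, SimpleGraph.Walk.length_cons,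
      SimpleGraph.Walk.take_length, SimpleGraph.Walk.drop_length] at this
    omega

/-- The vertices `b`, `c` and all vertices outside the closed neighbourhood of `v`. -/
def awayFrom {V : Type*} (G : SimpleGraph V) (v b c : V) : Set V :=
  {x | x = b ∨ x = c ∨ (x ≠ v ∧ ¬ G.Adj v x)}

/-- A shortest connecting path has length at least two and only its ends are adjacent to `v`; adding
`v` closes it to an induced cycle. -/
theorem IsChordal.not_reachable_awayFrom {V : Type*} {G : SimpleGraph V} (hG : IsChordal G)
    {v b c : V} (hvb : G.Adj v b) (hvc : G.Adj v c) (hne : b ≠ c) (hbc : ¬ G.Adj b c) :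
    ¬ (G.induce (awayFrom G v b c)).Reachable ⟨b, Or.inl rfl⟩ ⟨c, Or.inr (Or.inl rfl)⟩ := by
  intro hr
  obtain ⟨p, hp⟩ := hr.exists_walk_length_eq_dist
  have hgeo := fun i j => getVert_of_length_eq_dist p hp (i := i) (j := j)
  set q : ℕ → V := fun i => (p.getVert i).1 with hq
  have hq0 : q 0 = b := by simp [hq]
  have hql : q p.length = c := by simp [hq]
  have hl0 : p.length ≠ 0 := fun h => hne (by rw [← hq0, ← hql, h])
  have hadj : ∀ i, i < p.length → G.Adj (q i) (q (i + 1)) := fun i hi => p.adj_getVert_succ hi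
  have hl1 : p.length ≠ 1 := fun h => hbc (by
    have := hadj 0 (by omega)
    rwa [hq0, zero_add, ← h, hql] at this)
  have hqne : ∀ i j, i < j → j ≤ p.length → q i ≠ q j := fun i j hij hj h =>
    (hgeo i j hij hj).1 (Subtype.ext h)
  have hqv : ∀ i, q i ≠ v := by
    intro i h
    rcases (p.getVert i).2 with h1 | h1 | h1
    · exact hvb.ne (h.symm.trans h1)
    · exact hvc.ne (h.symm.trans h1)
    · exact h1.1 h
  have hqadj : ∀ i, i ≤ p.length → G.Adj (q i) v → i = 0 ∨ i = p.length := by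
    intro i hi h
    by_contra hcon
    rw [not_or] at hcon
    rcases (p.getVert i).2 with h1 | h1 | h1
    · exact hqne 0 i (by omega) hi (hq0.trans h1.symm)
    · exact hqne i p.length (by omega) le_rfl (h1.trans hql.symm)
    · exact h1.2 h.symm
  -- The path has `p.length + 1` vertices; `v` takes the last position of the cycle.
  refine hG (p.length + 2) (by omega)
    (isIndContained_cycleGraph (fun i => if i.1 ≤ p.length then q i.1 else v) ?_)
  rintro ⟨i, hi⟩ ⟨j, hj⟩ hij
  rw [Fin.mk_lt_mk] at hij
  have hil : i ≤ p.length := by omega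
  simp only [hil, if_true]
  by_cases hjl : j ≤ p.length
  · simp only [hjl, if_true]
    refine ⟨hqne i j hij hjl, fun h => Or.inl ((hgeo i j hij hjl).2 h), ?_⟩
    rintro (rfl | h)
    · exact hadj i (by omega)
    · omega
  · simp only [hjl, if_false]
    refine ⟨hqv i, fun h => ?_, ?_⟩
    · rcases hqadj i hil h with h | h <;> omega
    · intro h
      have h' : i = 0 ∨ i = p.length := by omega
      rcases h' with rfl | rfl
      · rw [hq0]; exact hvb.symm
      · rw [hql]; exact hvc.symm

/-! ### Numberings with the lexicographic breadth-first property -/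

/-- The four-point property of lexicographic breadth-first search. -/
def HasLexProperty {V : Type*} (G : SimpleGraph V) (f : V → ℕ) : Prop :=
  ∀ a b c, f a < f b → f b < f c → G.Adj a c → ¬ G.Adj b c →
    ∃ d, f c < f d ∧ G.Adj b d ∧ ¬ G.Adj a d

theorem HasLexProperty.isPerfectElimination {V : Type*} [Finite V] {G : SimpleGraph V}
    {f : V → ℕ} (hG : IsChordal G) (hinj : Function.Injective f) (hlex : HasLexProperty G f) :
    IsPerfectElimination G f := by
  refine ⟨fun x y h hxy => h.ne (hinj hxy), ?_⟩
  have key : ∀ v b c, G.Adj v b → G.Adj v c → f v < f b → f b < f c → G.Adj b c := by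
    intro v b c hvb hvc hb hc
    by_contra hbc
    have hsep := hG.not_reachable_awayFrom hvb hvc (by rintro rfl; exact lt_irrefl _ hc) hbc
    set U := awayFrom G v b c
    obtain ⟨N, hN⟩ := (Set.finite_range f).bddAbove
    have hN' : ∀ x, f x ≤ N := fun x => hN ⟨x, rfl⟩
    -- From a violating triple `p < q < r` the lexicographic property produces another, `q < r < z`,
    -- with a strictly larger top, so by finiteness there is none. Separation in `U` keeps the last
    -- two vertices of the triple non-adjacent; the condition on vertices above `r` keeps each new
    -- vertex inside `U`.
    have chain : ∀ (n : ℕ) (p : V) (q r : U), N - f r.1 = n → f p < f q.1 → f q.1 < f r.1 →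
        G.Adj p r → ¬ (G.induce U).Reachable q r →
        (∀ z, f r.1 < f z → ¬ G.Adj p z → ¬ G.Adj v z) → f v < f r.1 → False := by
      intro n
      induction n using Nat.strong_induction_on with
      | _ n ih =>
        intro p q r hn hpq hqr hpr hreach hdesc hvr
        have hqr' : ¬ G.Adj q r := fun h =>
          hreach (SimpleGraph.Adj.reachable (G := G.induce U) h)
        obtain ⟨d, hd, hqd, hpd⟩ := hlex p q r hpq hqr hpr hqr'
        -- Taking `z` largest makes every neighbour of `p` above `z` a neighbour of `q`, which
        -- carries the condition over to the next triple.
        obtain ⟨z, ⟨hqz, hpz⟩, hmax⟩ := Set.exists_max_image {z | G.Adj q z ∧ ¬ G.Adj p z} f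
          (Set.toFinite _) ⟨d, hqd, hpd⟩
        have hrz : f r.1 < f z := hd.trans_le (hmax d ⟨hqd, hpd⟩)
        have hvz : ¬ G.Adj v z := hdesc z hrz hpz
        have hzU : z ∈ U := Or.inr (Or.inr ⟨by rintro rfl; exact lt_asymm hvr hrz, hvz⟩)
        refine ih (N - f z) (by have := hN' z; omega) q r ⟨z, hzU⟩ rfl hqr hrz hqz ?_ ?_
          (hvr.trans hrz)
        · intro h
          have hqz' : (G.induce U).Reachable q ⟨z, hzU⟩ :=
            SimpleGraph.Adj.reachable (G := G.induce U) hqz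
          exact hreach (hqz'.trans h.symm)
        · intro y hzy hqy
          refine hdesc y (hrz.trans hzy) fun hpy => ?_
          obtain ⟨t, ht, hqt, hpt⟩ := hlex p q y hpq (hqr.trans (hrz.trans hzy)) hpy hqy
          exact absurd (hmax t ⟨hqt, hpt⟩) (not_le.mpr (hzy.trans ht))
    exact chain _ v ⟨b, Or.inl rfl⟩ ⟨c, Or.inr (Or.inl rfl)⟩ rfl hb hc hvc hsep
      (fun _ _ h => h) (hb.trans hc)
  intro v b c hvb hvc hb hc hne
  rcases lt_or_gt_of_ne (hinj.ne hne) with h | h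
  · exact key v b c hvb hvc hb h
  · exact (key v c b hvc hvb hc h).symm

/-! ### The ordering produced by lexicographic breadth-first search -/

/-- The bound on `Y` matters when `B` is a proper prefix of `A`. Label entries decrease, so a strict
comparison of labels survives all later numberings. -/
theorem append_lt_append_of_lt {B A Y : List ℕ} (X : List ℕ) (h : B < A)
    (hY : ∀ y ∈ Y, ∀ a ∈ A, y < a) : B ++ Y < A ++ X := by
  induction A generalizing B with
  | nil => exact absurd h (List.not_lt_nil _)
  | cons k A ih =>
    cases B with
    | nil =>
      cases Y with
      | nil => exact List.nil_lt_cons _ _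
      | cons y Y =>
        exact List.cons_lt_cons_iff.mpr (Or.inl (hY y (by simp) k (by simp)))
    | cons j B =>
      rw [List.cons_append, List.cons_append]
      rcases List.cons_lt_cons_iff.mp h with h | ⟨h1, h2⟩
      · exact List.cons_lt_cons_iff.mpr (Or.inl h)
      · exact List.cons_lt_cons_iff.mpr (Or.inr ⟨h1, ih h2 fun y hy a ha =>
          hY y hy a (List.mem_cons_of_mem _ ha)⟩)

section

variable {V : Type*} {G : SimpleGraph V}

theorem IsLexBFSList.nodup {L : List V} (h : IsLexBFSList G L) : L.Nodup := by
  induction h with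
  | nil => exact List.nodup_nil
  | cons v L _ hv _ ih => exact List.nodup_cons.mpr ⟨hv, ih⟩

theorem IsLexBFSList.drop {L : List V} (h : IsLexBFSList G L) (n : ℕ) :
    IsLexBFSList G (L.drop n) := by
  induction h generalizing n with
  | nil => rw [List.drop_nil]; exact .nil
  | cons v L hL hv hmax ih =>
    cases n with
    | zero => exact .cons v L hL hv hmax
    | succ n => exact ih n

theorem length_le_card_of_nodup [Finite V] {L : List V} (h : L.Nodup) :
    L.length ≤ Nat.card V := by
  have := Fintype.ofFinite V
  rw [Nat.card_eq_fintype_card]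
  exact h.length_le_card

/-- Without repetitions the list is no longer than the number of vertices, so the truncated
subtraction is exact. -/
theorem lt_of_mem_lexLabel [Finite V] {M : List V} (hM : M.Nodup) {w : V} {y : ℕ}
    (hy : y ∈ lexLabel G M w) : Nat.card V - M.length < y := by
  induction M with
  | nil => simp [lexLabel] at hy
  | cons x M ih =>
    have hlen := length_le_card_of_nodup hM
    have ih' := ih (List.nodup_cons.mp hM).2
    rw [List.length_cons] at hlen ⊢
    rw [lexLabel] at hy
    split_ifs at hy with h
    · rcases List.mem_append.mp hy with hy | hy
      · have := ih' hy
        omega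
      · rw [List.mem_singleton] at hy
        omega
    · have := ih' hy
      omega

theorem lexLabel_cons_lt [Finite V] {M : List V} (hM : M.Nodup) {a b : V}
    (h : lexLabel G M b < lexLabel G M a) (x : V) :
    lexLabel G (x :: M) b < lexLabel G (x :: M) a := by
  have hY : ∀ y ∈ [Nat.card V - M.length], ∀ z ∈ lexLabel G M a, y < z := by
    intro y hy z hz
    rw [List.mem_singleton] at hy
    exact hy ▸ lt_of_mem_lexLabel hM hz
  have hY' : ∀ y ∈ ([] : List ℕ), ∀ z ∈ lexLabel G M a, y < z := by simp
  rw [lexLabel, lexLabel]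
  split_ifs
  · exact append_lt_append_of_lt _ h hY
  · simpa using append_lt_append_of_lt [] h hY
  · simpa using append_lt_append_of_lt [Nat.card V - M.length] h hY'
  · exact h

theorem lexLabel_append_lt [Finite V] {N M : List V} (hM : (N ++ M).Nodup) {a b : V}
    (h : lexLabel G M b < lexLabel G M a) :
    lexLabel G (N ++ M) b < lexLabel G (N ++ M) a := by
  induction N with
  | nil => exact h
  | cons x N ih =>
    have hM' := (List.nodup_cons.mp hM).2
    exact lexLabel_cons_lt hM' (ih hM') x

theorem lexLabel_eq_or_lt [Finite V] {M : List V} (hM : M.Nodup) {a b : V}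
    (h : ∀ d ∈ M, G.Adj d b → G.Adj d a) :
    lexLabel G M b = lexLabel G M a ∨ lexLabel G M b < lexLabel G M a := by
  induction M with
  | nil => exact Or.inl rfl
  | cons x M ih =>
    have hM' := (List.nodup_cons.mp hM).2
    rcases ih hM' (fun d hd => h d (List.mem_cons_of_mem _ hd)) with ih | ih
    · have hx := h x (by simp)
      rw [lexLabel, lexLabel, ih]
      split_ifs with h1 h2
      · exact Or.inl rfl
      · exact absurd (hx h1) h2
      · right
        simpa using List.append_left_lt (l₁ := lexLabel G M a)
          (List.nil_lt_cons (Nat.card V - M.length) [])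
      · exact Or.inl rfl
    · exact Or.inr (lexLabel_cons_lt hM' ih x)

/-- Before `c` is numbered the label of `a` is at least that of `b`; `c` makes the inequality
strict, and it stays strict. -/
theorem lexLabel_lt [Finite V] {N M : List V} {c : V} (hM : (N ++ c :: M).Nodup) {a b : V}
    (hac : G.Adj c a) (hbc : ¬ G.Adj c b) (h : ∀ d ∈ M, G.Adj d b → G.Adj d a) :
    lexLabel G (N ++ c :: M) b < lexLabel G (N ++ c :: M) a := by
  have hcM : (c :: M).Nodup := hM.of_append_right
  refine lexLabel_append_lt hM ?_
  rcases lexLabel_eq_or_lt (List.nodup_cons.mp hcM).2 h with h | h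
  · rw [lexLabel, lexLabel, if_neg hbc, if_pos hac, h]
    simpa using List.append_left_lt (l₁ := lexLabel G M a)
      (List.nil_lt_cons (Nat.card V - M.length) [])
  · exact lexLabel_cons_lt (List.nodup_cons.mp hcM).2 h c

open Classical in
theorem mem_drop_iff_le_idxOf {L : List V} (hL : L.Nodup) {x : V} (hx : x ∈ L) (n : ℕ) :
    x ∈ L.drop n ↔ n ≤ L.idxOf x := by
  induction L generalizing n with
  | nil => simp at hx
  | cons y L ih =>
    obtain ⟨hy, hL⟩ := List.nodup_cons.mp hL
    cases n with
    | zero => simpa using hx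
    | succ n =>
      rw [List.drop_succ_cons]
      rcases List.mem_cons.mp hx with rfl | hxL
      · simp only [List.idxOf_cons_self, Nat.le_zero, Nat.add_eq_zero_iff, one_ne_zero, and_false,
          iff_false]
        exact fun h => hy (List.mem_of_mem_drop h)
      · rw [List.idxOf_cons_ne _ (by rintro rfl; exact hy hxL), ih hL hxL, Nat.succ_le_succ_iff]

open Classical in
theorem drop_idxOf {L : List V} {x : V} (hx : x ∈ L) :
    L.drop (L.idxOf x) = x :: L.drop (L.idxOf x + 1) := by
  have h := List.idxOf_lt_length_of_mem hx
  rw [List.drop_eq_getElem_cons h, List.getElem_idxOf h]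

open Classical in
theorem IsLexBFSOrdering.hasLexProperty [Finite V] {L : List V} (hL : IsLexBFSOrdering G L) :
    HasLexProperty G (fun x => L.idxOf x) := by
  intro a b c hab hbc hac hnbc
  beta_reduce at hab hbc
  have hnd := hL.1.nodup
  have hmem := fun x => mem_drop_iff_le_idxOf hnd (hL.2 x)
  by_contra hcon
  push Not at hcon
  have hb := hL.1.drop (L.idxOf b)
  rw [drop_idxOf (hL.2 b)] at hb
  obtain ⟨N, hN⟩ : ∃ N, L.drop (L.idxOf b + 1) = N ++ c :: L.drop (L.idxOf c + 1) := by
    obtain ⟨k, hk⟩ := Nat.exists_eq_add_of_le (Nat.succ_le_of_lt hbc)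
    refine ⟨(L.drop (L.idxOf b + 1)).take k, ?_⟩
    rw [← drop_idxOf (hL.2 c)]
    have hdrop : L.drop (L.idxOf c) = (L.drop (L.idxOf b + 1)).drop k := by
      rw [List.drop_drop, hk]
    rw [hdrop, List.take_append_drop]
  have hnd' := (hL.1.drop (L.idxOf b + 1)).nodup
  -- When `b` was chosen, exactly the vertices after it in `L` were numbered; `a` was not, and by
  -- `hcon` it had the larger label.
  cases hb with
  | cons _ _ _ _ hmax =>
    refine hmax a (fun h => ?_) ?_
    · have := (hmem a _).mp h
      omega
    · rw [hN] at hnd' ⊢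
      refine lexLabel_lt hnd' hac.symm (fun h => hnbc h.symm) fun d hd hdb => ?_
      exact (hcon d ((hmem d _).mp hd) hdb.symm).symm

open Classical in
theorem IsLexBFSOrdering.isPerfectElimination [Finite V] (hG : IsChordal G) {L : List V}
    (hL : IsLexBFSOrdering G L) : IsPerfectElimination G (fun x => L.idxOf x) :=
  hL.hasLexProperty.isPerfectElimination hG
    (fun x _ h => (List.idxOf_inj (hL.2 x)).mp h)

theorem exists_isLexBFSOrdering [Finite V] (G : SimpleGraph V) :
    ∃ L : List V, IsLexBFSOrdering G L := by
  have key : ∀ (n : ℕ) (L : List V), IsLexBFSList G L → Nat.card V - L.length = n →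
      ∃ L : List V, IsLexBFSOrdering G L := by
    intro n
    induction n using Nat.strong_induction_on with
    | _ n ih =>
      intro L hL hn
      by_cases hall : ∀ v, v ∈ L
      · exact ⟨L, hL, hall⟩
      · push Not at hall
        obtain ⟨v, hv, hmax⟩ := Set.exists_max_image {v | v ∉ L} (lexLabel G L)
          (Set.toFinite _) hall
        have hL' : IsLexBFSList G (v :: L) := .cons v L hL hv fun w hw => not_lt.mpr (hmax w hw)
        have hlen := length_le_card_of_nodup hL'.nodup
        rw [List.length_cons] at hlen
        exact ih _ (by rw [List.length_cons]; omega) (v :: L) hL' rfl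
  exact key _ [] .nil rfl

/-! ### Runs of the algorithm -/

theorem exists_run (G : SimpleGraph V) (S : Config V) :
    ∃ F, Relation.ReflTransGen (Step G) S F ∧ F.rest = [] := by
  obtain ⟨L, ec, vc, C⟩ := S
  induction L generalizing ec vc C with
  | nil => exact ⟨_, .refl, rfl⟩
  | cons v rest ih =>
    by_cases h : ∃ u ∈ rest, G.Adj v u ∧ ec s(v, u) = none
    · obtain ⟨u, hu, hadj, hnone⟩ := h
      obtain ⟨F, hF, hF'⟩ := ih _ _ _
      exact ⟨F, .head (.white v u rest ec vc C hu hadj hnone) hF, hF'⟩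
    · push Not at h
      obtain ⟨F, hF, hF'⟩ := ih _ _ _
      exact ⟨F, .head (.black v rest ec vc C h) hF, hF'⟩

theorem exists_isRunResult [Finite V] (G : SimpleGraph V) : ∃ F, IsRunResult G F := by
  obtain ⟨L, hL⟩ := exists_isLexBFSOrdering G
  obtain ⟨F, hF, hF'⟩ := exists_run G (Config.init L)
  exact ⟨F, L, hL, hF, hF'⟩

/-- The vertices coloured white in a configuration. -/
def Config.white (S : Config V) : Set V := {v | S.vertex v = some VertexColour.white}

/-- The invariant of a run for a numbering `f` that increases along the list of vertices: the
vertices already treated are those missing from `rest`. -/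
structure Config.Invariant (G : SimpleGraph V) (f : V → ℕ) (S : Config V) : Prop where
  sorted : S.rest.Pairwise fun x y => f x < f y
  lt_of_mem : ∀ v ∉ S.rest, ∀ u ∈ S.rest, f v < f u
  notMem_of_white : ∀ v ∈ S.white, v ∉ S.rest
  cliques_eq : S.cliques = upperNbhd G f '' S.white
  edge_eq_none : ∀ x y, G.Adj x y →
    (S.edge s(x, y) = none ↔ ∀ k ∈ S.white, ¬ (x ∈ upperNbhd G f k ∧ y ∈ upperNbhd G f k))
  exists_fresh : ∀ v ∈ S.white, ∃ u, G.Adj v u ∧ f v < f u ∧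
    ∀ k ∈ S.white, f k < f v → ¬ (v ∈ upperNbhd G f k ∧ u ∈ upperNbhd G f k)
  covered : ∀ v ∉ S.rest, v ∉ S.white → ∀ u, G.Adj v u → f v < f u →
    ∃ k ∈ S.white, v ∈ upperNbhd G f k ∧ u ∈ upperNbhd G f k

theorem Config.Invariant.mem_tail_iff {f : V → ℕ} {v : V} {rest : List V}
    {ec : Sym2 V → Option EdgeColour} {vc : V → Option VertexColour} {C : Set (Set V)}
    (h : Config.Invariant G f ⟨v :: rest, ec, vc, C⟩) (u : V) : u ∈ rest ↔ f v < f u := by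
  constructor
  · exact (List.pairwise_cons.mp h.sorted).1 u
  · intro hlt
    by_contra hu
    have hne : u ≠ v := by rintro rfl; exact lt_irrefl _ hlt
    have := h.lt_of_mem u (by simp [hne, hu]) v (by simp)
    exact lt_asymm hlt this

theorem Config.Invariant.lt_of_notMem_tail {f : V → ℕ} {v : V} {rest : List V}
    {ec : Sym2 V → Option EdgeColour} {vc : V → Option VertexColour} {C : Set (Set V)}
    (h : Config.Invariant G f ⟨v :: rest, ec, vc, C⟩) :
    ∀ x ∉ rest, ∀ u ∈ rest, f x < f u := by
  intro x hx u hu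
  by_cases hxv : x = v
  · subst hxv
    exact (h.mem_tail_iff u).mp hu
  · exact h.lt_of_mem x (by simp [hx, hxv]) u (by simp [hu])

theorem Config.Invariant.step {f : V → ℕ} {S S' : Config V} (h : S.Invariant G f)
    (hs : Step G S S') : S'.Invariant G f := by
  classical
  cases hs with
  | white v u rest ec vc C hu hadj hnone =>
    have hmem := h.mem_tail_iff
    have hvrest : v ∉ rest := fun hv => lt_irrefl _ ((hmem v).mp hv)
    have hvW : v ∉ Config.white ⟨v :: rest, ec, vc, C⟩ := fun hv =>
      h.notMem_of_white v hv (by simp)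
    have hK : closedNbhd G v rest = upperNbhd G f v := by
      ext x
      simp only [closedNbhd, upperNbhd, hmem, and_comm]
    have hW : Config.white ⟨rest, colourEdges G (closedNbhd G v rest) s(v, u) ec,
        Function.update vc v (some VertexColour.white), insert (closedNbhd G v rest) C⟩ =
        insert v (Config.white ⟨v :: rest, ec, vc, C⟩) := by
      ext x
      by_cases hx : x = v
      · subst hx; simp [Config.white]
      · simp [Config.white, hx]
    have hvu : f v < f u := (hmem u).mp hu
    refine ⟨(List.pairwise_cons.mp h.sorted).2, h.lt_of_notMem_tail, ?_, ?_, ?_, ?_, ?_⟩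
    · rw [hW]
      rintro x (rfl | hx)
      · exact hvrest
      · exact fun hx' => h.notMem_of_white x hx (by simp [hx'])
    · rw [hW, Set.image_insert_eq, ← h.cliques_eq, hK]
    -- Black and red play the same role here: the newly coloured edges are exactly the uncoloured
    -- ones inside the clique of `v`, the chosen edge included.
    · intro x y hxy
      rw [hW, Set.forall_mem_insert, ← h.edge_eq_none x y hxy, hK]
      change colourEdges G (upperNbhd G f v) s(v, u) ec s(x, y) = none ↔ _
      have hxy' : s(x, y) ∈ G.edgeSet := hxy
      have hball : (∀ z ∈ s(x, y), z ∈ upperNbhd G f v) ↔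
          x ∈ upperNbhd G f v ∧ y ∈ upperNbhd G f v := by simp
      unfold colourEdges
      split_ifs with h1 h2
      · have h3 : ∀ z ∈ s(x, y), z ∈ upperNbhd G f v := by
          rw [h1]
          simp [upperNbhd, hadj, hvu]
        simp [hball.mp h3]
      · simp [hball.mp h2.2.2]
      · refine ⟨fun h3 => ⟨fun h4 => h2 ⟨h3, hxy', hball.mpr h4⟩, h3⟩, fun h3 => h3.2⟩
    · rw [hW]
      rintro w (rfl | hw)
      · refine ⟨u, hadj, hvu, ?_⟩
        rintro k (rfl | hk) hlt
        · exact absurd hlt (lt_irrefl _)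
        · exact (h.edge_eq_none _ _ hadj).mp hnone k hk
      · obtain ⟨t, h1, h2, h3⟩ := h.exists_fresh w hw
        refine ⟨t, h1, h2, ?_⟩
        rintro k (rfl | hk) hlt
        -- The new white vertex comes after all those treated before, so their fresh edges stay
        -- fresh.
        · exact absurd (h.lt_of_mem w (h.notMem_of_white w hw) k (by simp)) (lt_asymm hlt)
        · exact h3 k hk hlt
    · rw [hW]
      intro w hw hwW t hwt hlt
      rw [Set.mem_insert_iff, not_or] at hwW
      have hw' : w ∉ rest := hw
      obtain ⟨k, hk, h1⟩ := h.covered w (by simp [hw', hwW.1]) hwW.2 t hwt hlt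
      exact ⟨k, Or.inr hk, h1⟩
  | black v rest ec vc C hall =>
    have hmem := h.mem_tail_iff
    have hvW : v ∉ Config.white ⟨v :: rest, ec, vc, C⟩ := fun hv =>
      h.notMem_of_white v hv (by simp)
    have hW : Config.white ⟨rest, ec, Function.update vc v (some VertexColour.black), C⟩ =
        Config.white ⟨v :: rest, ec, vc, C⟩ := by
      ext x
      by_cases hx : x = v
      · subst hx
        exact iff_of_false (by simp [Config.white]) hvW
      · simp [Config.white, hx]
    refine ⟨(List.pairwise_cons.mp h.sorted).2, h.lt_of_notMem_tail, ?_, ?_, ?_, ?_, ?_⟩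
    · rw [hW]
      exact fun x hx hx' => h.notMem_of_white x hx (by simp [show x ∈ rest from hx'])
    · rw [hW]; exact h.cliques_eq
    · rw [hW]; exact h.edge_eq_none
    · rw [hW]; exact h.exists_fresh
    · rw [hW]
      intro w hw hwW t hwt hlt
      by_cases hwv : w = v
      · subst hwv
        have := hall t ((hmem t).mpr hlt) hwt
        rw [ne_eq, h.edge_eq_none _ _ hwt] at this
        push Not at this
        exact this
      · exact h.covered w (by simp [show w ∉ rest from hw, hwv]) hwW t hwt hlt

open Classical in
theorem IsLexBFSOrdering.invariant_init {L : List V} (hL : IsLexBFSOrdering G L) :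
    (Config.init L).Invariant G (fun x => L.idxOf x) := by
  have hW : (Config.init L).white = ∅ := by
    ext x; simp [Config.init, Config.white]
  refine ⟨?_, fun v hv => absurd (hL.2 v) hv, ?_, ?_, ?_, ?_, fun v hv => absurd (hL.2 v) hv⟩
  · change L.Pairwise _
    rw [List.pairwise_iff_getElem]
    intro i j hi hj hij
    rwa [hL.1.nodup.idxOf_getElem, hL.1.nodup.idxOf_getElem]
  · simp [hW]
  · rw [hW, Set.image_empty]; rfl
  · rw [hW]; simp [Config.init]
  · simp [hW]

/-- A run yields a perfect elimination numbering for which its white vertices and the recorded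
cliques are as described by `IsWhiteSet`. -/
theorem IsRunResult.exists_numbering [Finite V] (hG : IsChordal G) {F : Config V}
    (hF : IsRunResult G F) : ∃ f : V → ℕ, IsPerfectElimination G f ∧ IsWhiteSet G f F.white ∧
      F.cliques = upperNbhd G f '' F.white := by
  classical
  obtain ⟨L, hL, hrun, hrest⟩ := hF
  have hinv : F.Invariant G (fun x => L.idxOf x) := by
    clear hrest
    induction hrun with
    | refl => exact hL.invariant_init
    | tail _ hs ih => exact ih.step hs
  exact ⟨_, hL.isPerfectElimination hG,
    ⟨hinv.exists_fresh, fun v hv => hinv.covered v (by simp [hrest]) hv⟩, hinv.cliques_eq⟩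

end

/-! ### Assembling the components -/

section

variable {V : Type*} {G : SimpleGraph V}

theorem upperNbhd_glue {f : ∀ c : G.ConnectedComponent, c.supp → ℕ} {g : V → ℕ}
    (hg : ∀ c (x : c.supp), g x = f c x) (c : G.ConnectedComponent) (v : c.supp) :
    upperNbhd G g v = Subtype.val '' upperNbhd (G.induce c.supp) (f c) v := by
  ext x
  constructor
  · rintro (rfl | ⟨hadj, hlt⟩)
    · exact ⟨v, Or.inl rfl, rfl⟩
    · have hx : x ∈ c.supp := c.mem_supp_of_adj_mem_supp v.2 hadj
      refine ⟨⟨x, hx⟩, Or.inr ⟨hadj, ?_⟩, rfl⟩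
      rwa [← hg c v, ← hg c ⟨x, hx⟩]
  · rintro ⟨y, rfl | ⟨hadj, hlt⟩, rfl⟩
    · exact Or.inl rfl
    · refine Or.inr ⟨hadj, ?_⟩
      rwa [hg c v, hg c y]

theorem IsResult.exists_numbering [Finite V] (hG : IsChordal G)
    {F : ∀ c : G.ConnectedComponent, Config c.supp} (hF : IsResult G F) :
    ∃ g : V → ℕ, IsPerfectElimination G g ∧ IsWhiteSet G g (whiteVertices F) ∧
      cliqueFamily F = upperNbhd G g '' whiteVertices F := by
  choose f hpeo hwhite hcl using fun c => (hF c).exists_numbering (hG.induce _)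
  -- Values may coincide across components; this is harmless because only numbers within a component
  -- are ever compared.
  let g : V → ℕ := fun v => f (G.connectedComponentMk v) ⟨v, rfl⟩
  have hg : ∀ c (x : c.supp), g x = f c x := by
    rintro _ ⟨x, rfl⟩
    rfl
  have hupper := upperNbhd_glue hg
  have hW : ∀ c (x : c.supp), x.1 ∈ whiteVertices F ↔ x ∈ (F c).white := by
    rintro c ⟨x, hx⟩
    constructor
    · rintro ⟨c', hx', h⟩
      obtain rfl : c' = c := hx'.symm.trans hx
      exact h
    · exact fun h => ⟨c, hx, h⟩
  have hlift : ∀ x y, G.Adj x y → ∃ c : G.ConnectedComponent, ∃ x' y' : c.supp,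
      x'.1 = x ∧ y'.1 = y := fun x y h =>
    ⟨G.connectedComponentMk x, ⟨x, rfl⟩, ⟨y, SimpleGraph.ConnectedComponent.mem_supp_of_adj_mem_supp
      _ rfl h⟩, rfl, rfl⟩
  have hmem : ∀ c (k x : c.supp), x.1 ∈ upperNbhd G g k ↔
      x ∈ (upperNbhd (G.induce c.supp) (f c) k : Set c.supp) := by
    intro c k x
    rw [hupper c k]
    exact Subtype.val_injective.mem_set_image
  refine ⟨g, ⟨?_, ?_⟩, ⟨?_, ?_⟩, ?_⟩
  · intro x y hxy
    obtain ⟨c, x, y, rfl, rfl⟩ := hlift x y hxy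
    rw [hg, hg]
    exact (hpeo c).ne_of_adj hxy
  · intro v x y hvx hvy hlx hly hne
    obtain ⟨c, v, x, rfl, rfl⟩ := hlift v x hvx
    obtain ⟨y, rfl⟩ : ∃ y' : c.supp, y'.1 = y := ⟨⟨y, c.mem_supp_of_adj_mem_supp v.2 hvy⟩, rfl⟩
    rw [hg, hg] at hlx hly
    exact (hpeo c).adj_of_lt (v := v) (b := x) (c := y) hvx hvy hlx hly
      (fun h => hne (congrArg _ h))
  · intro v hv
    obtain ⟨c, v, rfl⟩ : ∃ c : G.ConnectedComponent, ∃ v' : c.supp, v'.1 = v :=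
      ⟨G.connectedComponentMk v, ⟨v, rfl⟩, rfl⟩
    obtain ⟨u, hvu, hlt, hu⟩ := (hwhite c).exists_fresh v ((hW c v).mp hv)
    refine ⟨u, hvu, by rwa [hg, hg], fun k hk hkv hku => ?_⟩
    -- A recorded set containing `v` comes from the component of `v`.
    obtain ⟨k, rfl⟩ : ∃ k' : c.supp, k'.1 = k := by
      rcases hku.1 with h | h
      · exact ⟨v, h⟩
      · exact ⟨⟨k, c.mem_supp_of_adj_mem_supp v.2 h.1.symm⟩, rfl⟩
    rw [hg, hg] at hkv
    rw [hmem, hmem] at hku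
    exact hu k ((hW c k).mp hk) hkv hku
  · intro v hv u hvu hlt
    obtain ⟨c, v, u, rfl, rfl⟩ := hlift v u hvu
    rw [hg, hg] at hlt
    obtain ⟨k, hk, h⟩ := (hwhite c).covered v (fun h => hv ((hW c v).mpr h)) u hvu hlt
    exact ⟨k, (hW c k).mpr hk, (hmem c k v).mpr h.1, (hmem c k u).mpr h.2⟩
  · ext K
    constructor
    · rintro ⟨c, K', hK', rfl⟩
      rw [hcl c] at hK'
      obtain ⟨v, hv, rfl⟩ := hK'
      exact ⟨v, (hW c v).mpr hv, hupper c v⟩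
    · rintro ⟨v, ⟨c, hvc, hv⟩, rfl⟩
      refine ⟨c, _, ?_, hupper c ⟨v, hvc⟩⟩
      rw [hcl c]
      exact ⟨_, hv, rfl⟩

theorem exists_isResult [Finite V] (G : SimpleGraph V) :
    ∃ F : ∀ c : G.ConnectedComponent, Config c.supp, IsResult G F := by
  choose F hF using fun c : G.ConnectedComponent => exists_isRunResult (G.induce c.supp)
  exact ⟨F, hF⟩

end

end ZplusChordal

theorem mainTheorem6 {V : Type*} [Finite V] (G : SimpleGraph V)
    (hG : ZplusChordal.IsChordal G) :
    (∃ F : ∀ c : G.ConnectedComponent, ZplusChordal.Config c.supp, ZplusChordal.IsResult G F) ∧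
    (∀ F : ∀ c : G.ConnectedComponent, ZplusChordal.Config c.supp, ZplusChordal.IsResult G F →
      ZplusChordal.IsOptimalCliqueCover G (ZplusChordal.cliqueFamily F) ∧
      (ZplusChordal.cliqueFamily F).ncard = (ZplusChordal.whiteVertices F).ncard) ∧
    (Nat.card V : ℤ) - (ZplusChordal.cliqueCoverNumber G : ℤ) =
      (ZplusChordal.posZeroForcingNumber G : ℤ) := by
  have hex := ZplusChordal.exists_isResult G
  refine ⟨hex, fun F hF => ?_, ?_⟩
  · obtain ⟨g, hg, hW, hfam⟩ := hF.exists_numbering hG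
    have hcard : (ZplusChordal.cliqueFamily F).ncard = (ZplusChordal.whiteVertices F).ncard := by
      rw [hfam]
      exact (hW.injOn_upperNbhd hg).ncard_image
    refine ⟨⟨hfam ▸ hW.isCliqueCover hg, fun D hD => ?_⟩, hcard⟩
    rw [hcard]
    exact hW.ncard_le hg hD
  · obtain ⟨F, hF⟩ := hex
    obtain ⟨g, hg, hW, -⟩ := hF.exists_numbering hG
    exact hW.card_sub_cliqueCoverNumber hg
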